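/- For $f:\{0,1\}^n\to\{0,1\}$ and $x\in\{0,1\}^n$, a certificate for $f$'s value at $x$ is a set $S\subseteq[n]$ such that $f(y)=f(x)$ for all $y$ that agree with $x$ on $S$; $\mathrm{Cert}(f,x)$ is the size of a smallest one, and $\mathrm{Cert}(f)=\max_x \mathrm{Cert}(f,x)$. A restriction $\pi$ fixes some of the $n$ variables to constants, $|\pi|$ is the number of variables it fixes, and $f_\pi$ is the resulting function of the remaining variables. There are a language $L\in\mathsf{NP}$, a randomized algorithm $\mathcal A$ with oracle access to $L$, a polynomial $p$ and a constant $K$ such that the following holds for every $n\in\mathbb N$, every Boolean circuit computing a function $f:\{0,1\}^n\to\{0,1\}$, with $s$ gates, and every $\delta\in(0,1)$. Given the circuit and $\lceil\log_2(1/\delta)\rceil$, the algorithm $\mathcal A$ halts within $p(n,s,\log(1/\delta))$ steps for all outcomes of its coin tosses, and with probability at least $1-\delta$ it outputs a restriction $\pi$ with $|\pi|\le K\cdot \mathrm{Cert}(f)^4$ such that $f_\pi$ is a constant function. In particular, on circuits of size $\mathrm{poly}(n)$ the running time is $\mathrm{poly}(n,\log(1/\delta))$. -/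

import Mathlib

namespace Certification

/-! ### Certificates and restrictions of Boolean functions -/

/-- `S` is a certificate for the value of `f` at `x`. -/
def IsCertificate {n : ℕ} (f : (Fin n → Bool) → Bool) (x : Fin n → Bool)
    (S : Finset (Fin n)) : Prop :=
  ∀ y : Fin n → Bool, (∀ i ∈ S, y i = x i) → f y = f x

/-- The size of a smallest certificate for the value of `f` at `x`. (The set of sizes is never
empty, since the set of all coordinates is a certificate.) -/
noncomputable def certAt {n : ℕ} (f : (Fin n → Bool) → Bool) (x : Fin n → Bool) : ℕ :=
  sInf {k : ℕ | ∃ S : Finset (Fin n), IsCertificate f x S ∧ S.card = k}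

/-- The certificate complexity of `f`: the maximum of `certAt f x` over all inputs `x`. -/
noncomputable def cert {n : ℕ} (f : (Fin n → Bool) → Bool) : ℕ :=
  Finset.univ.sup (certAt f)

/-- A restriction: `some b` means that the variable is fixed to `b`, `none` that it is free. -/
abbrev Restriction (n : ℕ) : Type := Fin n → Option Bool

/-- The number of variables that a restriction fixes. -/
def Restriction.length {n : ℕ} (π : Restriction n) : ℕ :=
  (Finset.univ.filter fun i => (π i).isSome).card

/-- The restricted function `f_π`, as a function of all variables that ignores the fixed ones. -/
def restrict {n : ℕ} (f : (Fin n → Bool) → Bool) (π : Restriction n) : (Fin n → Bool) → Bool :=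
  fun x => f fun i => (π i).getD (x i)

/-- `g` is a constant function. -/
def IsConstant {n : ℕ} (g : (Fin n → Bool) → Bool) : Prop :=
  ∃ b : Bool, ∀ x, g x = b

/-! ### Boolean circuits -/

/-- The gates of a circuit; the natural numbers are the wires that enter the gate. -/
inductive Gate : Type
  | const (b : Bool)
  | not (u : ℕ)
  | and (u v : ℕ)
  | or (u v : ℕ)

namespace Gate

/-- All wires that enter the gate are among the wires `0, …, m - 1`. -/
def Below (m : ℕ) : Gate → Prop
  | const _ => True
  | not u => u < m
  | and u v => u < m ∧ v < m
  | or u v => u < m ∧ v < m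

/-- The value of the gate when the wires carry the values `w`. -/
def eval (w : ℕ → Bool) : Gate → Bool
  | const b => b
  | not u => !(w u)
  | and u v => w u && w v
  | or u v => w u || w v

/-- Numerical code of the kind of gate. -/
def kind : Gate → ℕ
  | const false => 0
  | const true => 1
  | not _ => 2
  | and _ _ => 3
  | or _ _ => 4

/-- The first entering wire (`0` if there is none). -/
def fst : Gate → ℕ
  | const _ => 0
  | not u => u
  | and u _ => u
  | or u _ => u

/-- The second entering wire (`0` if there is none). -/
def snd : Gate → ℕ
  | const _ => 0
  | not _ => 0
  | and _ v => v
  | or _ v => v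

end Gate

/-- Boolean circuits on `n` inputs. Wires `0, …, n - 1` are the inputs, wire `n + j` is the output
of gate number `j`, whose entering wires must all come earlier. -/
structure Circuit (n : ℕ) where
  gates : List Gate
  output : ℕ
  wf : ∀ (j : ℕ) (h : j < gates.length), (gates[j]'h).Below (n + j)
  output_lt : output < n + gates.length

namespace Circuit

/-- The number of gates. -/
def size {n : ℕ} (C : Circuit n) : ℕ := C.gates.length

/-- The values of all wires, in order, on input `x`. -/
def wires {n : ℕ} (C : Circuit n) (x : Fin n → Bool) : List Bool :=
  C.gates.foldl (fun v g => v ++ [g.eval fun u => v.getD u false]) (List.ofFn x)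

/-- The Boolean function that the circuit computes. -/
def eval {n : ℕ} (C : Circuit n) (x : Fin n → Bool) : Bool :=
  (C.wires x).getD C.output false

end Circuit

/-! ### Randomized oracle RAM programs with a step count -/

/-- The memory of a random access machine: `m a i` is cell number `i` of array number `a`. A
program mentions finitely many arrays only. -/
abbrev Memory : Type := ℕ → ℕ → ℕ

/-- Arithmetic expressions: constants, (indirect) memory access, addition, truncated subtraction,
comparison. There is no multiplication, so one step adds only a constant number of bits to the
largest stored number, and unit cost per step is polynomially equivalent to Turing machine time. -/
inductive Expr : Type
  | const (k : ℕ)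
  | read (a : ℕ) (i : Expr)
  | add (e e' : Expr)
  | sub (e e' : Expr)
  | lt (e e' : Expr)

/-- The value of an expression. -/
def Expr.eval (m : Memory) : Expr → ℕ
  | const k => k
  | read a i => m a (i.eval m)
  | add e e' => e.eval m + e'.eval m
  | sub e e' => e.eval m - e'.eval m
  | lt e e' => if e.eval m < e'.eval m then 1 else 0

/-- Programs.
* `assign a i e` stores the value of `e` in cell `i` of array `a`;
* `flip a i` tosses a fair coin and stores the result (`0` or `1`) in cell `i` of array `a`;
* `query a l b` asks the oracle about the bit string held by the first `l` cells of array `a`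
  (nonzero means `true`) and stores the answer (`0` or `1`) in cell `0` of array `b`;
* the rest is sequential composition, branching and looping; a condition is true if nonzero. -/
inductive Prog : Type
  | skip
  | assign (a : ℕ) (i e : Expr)
  | flip (a : ℕ) (i : Expr)
  | query (a : ℕ) (l : Expr) (b : ℕ)
  | seq (p q : Prog)
  | ite (e : Expr) (p q : Prog)
  | loop (e : Expr) (p : Prog)

/-- Overwrite cell `i` of array `a` with `k`. -/
def Memory.write (m : Memory) (a i k : ℕ) : Memory :=
  fun a' i' => if a' = a ∧ i' = i then k else m a' i'

/-- The bit string held by the first `l` cells of array `a`. -/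
def Memory.bits (m : Memory) (a l : ℕ) : List Bool :=
  (List.range l).map fun i => decide (m a i ≠ 0)

/-- The state of a computation: the memory and the number of coins tossed so far. -/
structure State where
  mem : Memory
  coins : ℕ

open Classical in
/-- `Exec L ω p s s' t`: with oracle `L` and coin tosses `ω 0, ω 1, …`, the program `p`, started in
state `s`, halts in state `s'` after `t` steps. Assignments, coin tosses and tests of conditions
cost one step each, a query costs one step plus the length of the query string. -/
inductive Exec (L : Set (List Bool)) (ω : ℕ → Bool) : Prog → State → State → ℕ → Prop
  | skip (s : State) : Exec L ω .skip s s 1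
  | assign (s : State) (a : ℕ) (i e : Expr) :
      Exec L ω (.assign a i e) s ⟨s.mem.write a (i.eval s.mem) (e.eval s.mem), s.coins⟩ 1
  | flip (s : State) (a : ℕ) (i : Expr) :
      Exec L ω (.flip a i) s
        ⟨s.mem.write a (i.eval s.mem) (if ω s.coins then 1 else 0), s.coins + 1⟩ 1
  | query (s : State) (a : ℕ) (l : Expr) (b : ℕ) :
      Exec L ω (.query a l b) s
        ⟨s.mem.write b 0 (if s.mem.bits a (l.eval s.mem) ∈ L then 1 else 0), s.coins⟩
        (l.eval s.mem + 1)
  | seq (p q : Prog) (s s' s'' : State) (t t' : ℕ) :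
      Exec L ω p s s' t → Exec L ω q s' s'' t' → Exec L ω (.seq p q) s s'' (t + t')
  | ite_true (e : Expr) (p q : Prog) (s s' : State) (t : ℕ) :
      e.eval s.mem ≠ 0 → Exec L ω p s s' t → Exec L ω (.ite e p q) s s' (t + 1)
  | ite_false (e : Expr) (p q : Prog) (s s' : State) (t : ℕ) :
      e.eval s.mem = 0 → Exec L ω q s s' t → Exec L ω (.ite e p q) s s' (t + 1)
  | loop_true (e : Expr) (p : Prog) (s s' s'' : State) (t t' : ℕ) :
      e.eval s.mem ≠ 0 → Exec L ω p s s' t → Exec L ω (.loop e p) s' s'' t' →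
        Exec L ω (.loop e p) s s'' (t + t' + 1)
  | loop_false (e : Expr) (p : Prog) (s : State) :
      e.eval s.mem = 0 → Exec L ω (.loop e p) s s 1

/-! ### The class NP -/

/-- The memory that holds a pair of bit strings: array `0` holds their lengths, arrays `1` and `2`
their bits. All other cells are `0`. -/
def pairMemory (x y : List Bool) : Memory
  | 0 => fun i => [x.length, y.length].getD i 0
  | 1 => fun i => if x.getD i false then 1 else 0
  | 2 => fun i => if y.getD i false then 1 else 0
  | _ => fun _ => 0

/-- `L` is in NP: some deterministic polynomial-time verifier `V` accepts `(x, y)`, for some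
witness `y` of length polynomial in that of `x`, if and only if `x ∈ L`. The verifier runs with the
empty oracle and with all coins equal to `false`, so it is an ordinary deterministic program. It
accepts by halting with a nonzero number in cell `0` of array `0`. -/
def InNP (L : Set (List Bool)) : Prop :=
  ∃ (V : Prog) (c : ℕ),
    (∀ x y : List Bool, ∃ (s : State) (t : ℕ),
      Exec ∅ (fun _ => false) V ⟨pairMemory x y, 0⟩ s t ∧ t ≤ c * (x.length + y.length + 1) ^ c) ∧
    (∀ x : List Bool, x ∈ L ↔
      ∃ y : List Bool, y.length ≤ c * (x.length + 1) ^ c ∧ ∃ (s : State) (t : ℕ),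
        Exec ∅ (fun _ => false) V ⟨pairMemory x y, 0⟩ s t ∧ s.mem 0 0 ≠ 0)

/-! ### Input, output and randomness of the algorithm -/

/-- The memory that holds a circuit and a confidence parameter `r`: array `0` holds the numbers of
inputs and of gates, the output wire and `r`; arrays `1`, `2`, `3` hold, for each gate, its kind and
its entering wires. All other cells are `0`. -/
def inputMemory {n : ℕ} (C : Circuit n) (r : ℕ) : Memory
  | 0 => fun i => [n, C.size, C.output, r].getD i 0
  | 1 => fun j => (C.gates.map Gate.kind).getD j 0
  | 2 => fun j => (C.gates.map Gate.fst).getD j 0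
  | 3 => fun j => (C.gates.map Gate.snd).getD j 0
  | _ => fun _ => 0

/-- The restriction that the algorithm outputs, read from array `0` of the final memory: cell `i`
is `1` if variable `i` is fixed to `false`, `2` if it is fixed to `true`, and anything else if it is
free. -/
def outputRestriction (n : ℕ) (m : Memory) : Restriction n :=
  fun i => if m 0 i = 1 then some false else if m 0 i = 2 then some true else none

/-- The law of an infinite sequence of independent fair coin tosses. -/
noncomputable def coinMeasure : MeasureTheory.Measure (ℕ → Bool) :=
  MeasureTheory.Measure.infinitePi fun _ : ℕ => (PMF.uniformOfFintype Bool).toMeasure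

end Certification

open Certification

namespace Certification

/-! ### Deterministic execution and total correctness with a time bound -/

/-! A deterministic algorithm achieves the stronger bound `Cert(f)^2`, so every coin sequence
succeeds. Let b be the value of f at the zero vector. Keep a set S of variables, all fixed to 0.
While f differs from b at the indicator vector of some subset of the free variables, choose an
inclusion-minimal such subset T and add it to S. When no such subset is left, the restricted
function is constantly b.

Two facts bound S. By minimality of T, flipping any coordinate of T changes f at the indicator
vector of T, so every certificate there contains T and |T| ≤ Cert(f)
(`Circuit.card_le_cert_of_sensitive`). Moreover, a certificate Z of the zero vector with |Z| ≤
Cert(f) meets every such T (`Circuit.exists_hitting_set`); the sets T are disjoint, so |S| ≤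
Cert(f)·|S ∩ Z| ≤ Cert(f)^2. The loop in `certifyProg_runs` maintains this inequality.

The search for T uses only queries "does f differ from b at some subset of T?". These are instances
of circuit satisfiability in a unary code, which `codeLanguage_inNP` puts in NP. One greedy pass of
such queries makes T minimal (`shrinkProg_runs`). -/

theorem Exec.deterministic {L : Set (List Bool)} {ω : ℕ → Bool} {p : Prog} {s s₁ : State} {t₁ : ℕ}
    (h₁ : Exec L ω p s s₁ t₁) : ∀ {s₂ : State} {t₂ : ℕ}, Exec L ω p s s₂ t₂ → s₁ = s₂ ∧ t₁ = t₂ := by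
  induction h₁ with
  | skip s => intro s₂ t₂ h; cases h; exact ⟨rfl, rfl⟩
  | assign s a i e => intro s₂ t₂ h; cases h; exact ⟨rfl, rfl⟩
  | flip s a i => intro s₂ t₂ h; cases h; exact ⟨rfl, rfl⟩
  | query s a l b => intro s₂ t₂ h; cases h; exact ⟨rfl, rfl⟩
  | seq p q s s' s'' t t' _ _ ih ih' =>
    intro s₂ t₂ h
    cases h with
    | seq _ _ _ r _ _ _ hp hq =>
      obtain ⟨rfl, rfl⟩ := ih hp
      obtain ⟨rfl, rfl⟩ := ih' hq
      exact ⟨rfl, rfl⟩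
  | ite_true e p q s s' t he _ ih =>
    intro s₂ t₂ h
    cases h with
    | ite_true _ _ _ _ _ _ _ hp => obtain ⟨rfl, rfl⟩ := ih hp; exact ⟨rfl, rfl⟩
    | ite_false _ _ _ _ _ _ he' _ => exact absurd he' he
  | ite_false e p q s s' t he _ ih =>
    intro s₂ t₂ h
    cases h with
    | ite_true _ _ _ _ _ _ he' _ => exact absurd he he'
    | ite_false _ _ _ _ _ _ _ hp => obtain ⟨rfl, rfl⟩ := ih hp; exact ⟨rfl, rfl⟩
  | loop_true e p s s' s'' t t' he _ _ ih ih' =>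
    intro s₂ t₂ h
    cases h with
    | loop_true _ _ _ _ _ _ _ _ hp hq =>
      obtain ⟨rfl, rfl⟩ := ih hp
      obtain ⟨rfl, rfl⟩ := ih' hq
      exact ⟨rfl, rfl⟩
    | loop_false _ _ _ he' => exact absurd he' he
  | loop_false e p s he =>
    intro s₂ t₂ h
    cases h with
    | loop_true _ _ _ _ _ _ _ he' _ _ => exact absurd he he'
    | loop_false _ _ _ _ => exact ⟨rfl, rfl⟩

/-- Started with memory `m`, the program `p` halts within `T` steps without tossing coins, and the
final memory satisfies `Q`. -/
def Runs (L : Set (List Bool)) (ω : ℕ → Bool) (p : Prog) (m : Memory) (T : ℕ)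
    (Q : Memory → Prop) : Prop :=
  ∀ c : ℕ, ∃ (m' : Memory) (t : ℕ), Exec L ω p ⟨m, c⟩ ⟨m', c⟩ t ∧ t ≤ T ∧ Q m'

namespace Runs

variable {L : Set (List Bool)} {ω : ℕ → Bool} {p q : Prog} {m : Memory} {T T' : ℕ}
  {Q Q' R : Memory → Prop} {e : Expr}

theorem mono (h : Runs L ω p m T Q) (hT : T ≤ T') (hQ : ∀ m', Q m' → Q' m') :
    Runs L ω p m T' Q' := fun c => by
  obtain ⟨m', t, he, ht, hq⟩ := h c
  exact ⟨m', t, he, ht.trans hT, hQ _ hq⟩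

theorem assign {a : ℕ} {i : Expr} (h : Q (m.write a (i.eval m) (e.eval m))) :
    Runs L ω (.assign a i e) m 1 Q :=
  fun _ => ⟨_, _, Exec.assign _ _ _ _, le_rfl, h⟩

open Classical in
theorem query {a b : ℕ} {l : Expr}
    (h : Q (m.write b 0 (if m.bits a (l.eval m) ∈ L then 1 else 0))) :
    Runs L ω (.query a l b) m (l.eval m + 1) Q :=
  fun _ => ⟨_, _, Exec.query _ _ _ _, le_rfl, h⟩

theorem seq (hp : Runs L ω p m T R) (hq : ∀ m', R m' → Runs L ω q m' T' Q) :
    Runs L ω (.seq p q) m (T + T') Q := fun c => by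
  obtain ⟨m', t, he, ht, hr⟩ := hp c
  obtain ⟨m'', t', he', ht', hq'⟩ := hq m' hr c
  exact ⟨m'', t + t', Exec.seq _ _ _ _ _ _ _ he he', add_le_add ht ht', hq'⟩

theorem assign_seq {a : ℕ} {i : Expr}
    (h : Runs L ω q (m.write a (i.eval m) (e.eval m)) T Q) :
    Runs L ω (.seq (.assign a i e) q) m (1 + T) Q :=
  seq (R := fun m' => m' = m.write a (i.eval m) (e.eval m)) (assign rfl) (by rintro _ rfl; exact h)

theorem ite (hp : e.eval m ≠ 0 → Runs L ω p m T Q) (hq : e.eval m = 0 → Runs L ω q m T Q) :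
    Runs L ω (.ite e p q) m (T + 1) Q := fun c => by
  by_cases h : e.eval m = 0
  · obtain ⟨m', t, he, ht, hr⟩ := hq h c
    exact ⟨m', t + 1, Exec.ite_false _ _ _ _ _ _ h he, by omega, hr⟩
  · obtain ⟨m', t, he, ht, hr⟩ := hp h c
    exact ⟨m', t + 1, Exec.ite_true _ _ _ _ _ _ h he, by omega, hr⟩

/-- Loops whose potential `k` decreases in each round. -/
theorem loop_potential {B : ℕ} (I : ℕ → Memory → Prop)
    (step : ∀ k m, I k m → e.eval m ≠ 0 → Runs L ω p m B fun m' => ∃ k' < k, I k' m') :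
    ∀ (k : ℕ) (m : Memory), I k m →
      Runs L ω (.loop e p) m (k * (B + 1) + 1) fun m' => (∃ k', I k' m') ∧ e.eval m' = 0 := by
  intro k
  induction k using Nat.strong_induction_on with
  | _ k ih =>
    intro m hm c
    by_cases h : e.eval m = 0
    · exact ⟨m, 1, Exec.loop_false _ _ _ h, by omega, ⟨k, hm⟩, h⟩
    · obtain ⟨m', t, he, ht, k', hk', hI⟩ := step k m hm h c
      obtain ⟨m'', t', he', ht', hq⟩ := ih k' hk' m' hI c
      refine ⟨m'', t + t' + 1, Exec.loop_true _ _ _ _ _ _ _ h he he', ?_, hq⟩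
      have : (k' + 1) * (B + 1) ≤ k * (B + 1) := Nat.mul_le_mul_right _ hk'
      have : (k' + 1) * (B + 1) = k' * (B + 1) + B + 1 := by ring
      omega

/-- Loops with a known number `N` of rounds. -/
theorem loop_count {B : ℕ} (I : ℕ → Memory → Prop) (N : ℕ)
    (step : ∀ k m, k < N → I k m → e.eval m ≠ 0 ∧ Runs L ω p m B (I (k + 1)))
    (exit : ∀ m, I N m → e.eval m = 0) (h0 : I 0 m) :
    Runs L ω (.loop e p) m (N * (B + 1) + 1) (I N) := by
  -- The potential is the number of rounds left.
  have key := loop_potential (L := L) (ω := ω) (e := e) (p := p) (B := B)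
    (fun k m => k ≤ N ∧ I (N - k) m) (by
      rintro k m ⟨hk, hI⟩ he
      rcases Nat.eq_zero_or_pos k with rfl | hpos
      · exact absurd (exit m hI) he
      · refine (step (N - k) m (by omega) hI).2.mono le_rfl fun m' h => ?_
        refine ⟨k - 1, by omega, by omega, ?_⟩
        rwa [show N - (k - 1) = N - k + 1 by omega])
    N m ⟨le_rfl, by simpa using h0⟩
  refine key.mono le_rfl ?_
  rintro m' ⟨⟨k, hk, hI⟩, he⟩
  rcases Nat.eq_zero_or_pos k with rfl | hpos
  · exact hI
  · exact absurd he (step (N - k) m' (by omega) hI).1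

end Runs

/-! ### Memory access -/

namespace Memory

-- Phrased for a whole array, because the loop invariants describe arrays as functions.
@[simp] theorem write_same (m : Memory) (a i k : ℕ) :
    m.write a i k a = Function.update (m a) i k := by
  funext j
  by_cases h : j = i <;> simp [write, Function.update, h]

theorem write_ne (m : Memory) {a a' : ℕ} (i k : ℕ) (h : a' ≠ a) : m.write a i k a' = m a' := by
  funext j
  simp [write, h]

theorem bits_length (m : Memory) (a l : ℕ) : (m.bits a l).length = l := by
  simp [bits]

/-- Appending a bit to a bit string. -/
theorem bits_write_succ (m : Memory) (a l k : ℕ) :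
    (m.write a l k).bits a (l + 1) = m.bits a l ++ [decide (k ≠ 0)] := by
  unfold bits
  rw [List.range_succ, List.map_append]
  congr 1
  · apply List.map_congr_left
    intro i hi
    have : i ≠ l := (List.mem_range.1 hi).ne
    simp [this]
  · simp

theorem bits_congr {m m' : Memory} {a : ℕ} (h : m' a = m a) (l : ℕ) : m'.bits a l = m.bits a l := by
  simp [bits, h]

end Memory

/-! ### Unary encoding of lists of numbers -/

/-- Each number `k` is written as `k` ones followed by a zero. -/
def unary (ks : List ℕ) : List Bool :=
  ks.flatMap fun k => List.replicate k true ++ [false]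

/-- One step of decoding: `D` holds the numbers decoded so far, `k` the number of ones since then. -/
def unaryStep : List ℕ × ℕ → Bool → List ℕ × ℕ
  | (D, k), true => (D, k + 1)
  | (D, k), false => (D ++ [k], 0)

/-- The numbers that a bit string encodes; every bit string is a code, trailing ones are ignored. -/
def unaryDecode (x : List Bool) : List ℕ :=
  (x.foldl unaryStep ([], 0)).1

theorem foldl_unaryStep_replicate (k : ℕ) (D : List ℕ) (j : ℕ) :
    (List.replicate k true).foldl unaryStep (D, j) = (D, j + k) := by
  induction k generalizing j with
  | zero => rfl
  | succ k ih => rw [List.replicate_succ, List.foldl_cons, unaryStep, ih]; congr 1; omega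

theorem foldl_unaryStep_unary (ks D : List ℕ) :
    (unary ks).foldl unaryStep (D, 0) = (D ++ ks, 0) := by
  induction ks generalizing D with
  | nil => simp [unary]
  | cons k ks ih =>
    have h : unary (k :: ks) = List.replicate k true ++ [false] ++ unary ks := by simp [unary]
    rw [h, List.foldl_append, List.foldl_append, foldl_unaryStep_replicate]
    simp only [List.foldl_cons, List.foldl_nil, unaryStep, zero_add, ih]
    simp

theorem unaryDecode_unary (ks : List ℕ) : unaryDecode (unary ks) = ks := by
  simp [unaryDecode, foldl_unaryStep_unary]

theorem unary_append (ks ks' : List ℕ) : unary (ks ++ ks') = unary ks ++ unary ks' := by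
  simp [unary]

theorem length_unary_le {ks : List ℕ} {M : ℕ} (h : ∀ k ∈ ks, k ≤ M) :
    (unary ks).length ≤ ks.length * (M + 1) := by
  induction ks with
  | nil => simp [unary]
  | cons k ks ih =>
    have h1 := ih fun k hk => h k (List.mem_cons_of_mem _ hk)
    have h2 := h k List.mem_cons_self
    simp only [unary, List.flatMap_cons, List.length_append] at h1 ⊢
    simp only [List.length_replicate, List.length_cons, List.length_nil, add_mul]
    omega

/-- Each decoded number uses up a zero of the string. This makes the verifier linear-time and bounds
the length of witnesses. -/
theorem length_unaryDecode_le (x : List Bool) : (unaryDecode x).length ≤ x.length := by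
  suffices h : ∀ (x : List Bool) (D : List ℕ) (k : ℕ),
      (x.foldl unaryStep (D, k)).1.length ≤ D.length + x.length by
    simpa [unaryDecode] using h x [] 0
  intro x
  induction x with
  | nil => simp
  | cons b x ih =>
    intro D k
    cases b
    · exact (ih _ _).trans (by simp; omega)
    · exact (ih _ _).trans (by simp)

/-! ### The verifier -/

/-- The value of a coded gate of kind `k` with entering wires `u` and `v`. The kinds are those of
`Gate.kind`; in addition, kind `5` is a wire that carries the witness bit `b`. -/
def codeGate (w : ℕ → Bool) (b : Bool) (k u v : ℕ) : Bool :=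
  match k with
  | 1 => true
  | 2 => !(w u)
  | 3 => w u && w v
  | 4 => w u || w v
  | 5 => b
  | _ => false

/-- The values of the first `j` wires of the circuit with code `D`, with witness `y`. -/
def codeWires (D : List ℕ) (y : List Bool) : ℕ → List Bool
  | 0 => []
  | j + 1 => codeWires D y j ++ [codeGate (fun u => (codeWires D y j).getD u false)
      (y.getD j false) (D.getD (3 * j) 0) (D.getD (3 * j + 1) 0) (D.getD (3 * j + 2) 0)]

/-- The value of the last wire of the circuit with code `D`, with witness `y`. -/
def codeAccepts (D : List ℕ) (y : List Bool) : Bool :=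
  (codeWires D y ((D.length + 2) / 3)).getD ((D.length + 2) / 3 - 1) false

theorem length_codeWires (D : List ℕ) (y : List Bool) (j : ℕ) : (codeWires D y j).length = j := by
  induction j with
  | zero => rfl
  | succ j ih => simp [codeWires, ih]

/-- Memory stores a list as a function with a default value beyond its end, so appending an entry is
a single write. The decoder and the evaluator both grow their output in this way. -/
theorem update_getD_append {α β : Type*} (f : α → β) (l : List α) (a d : α) :
    Function.update (fun i => f (l.getD i d)) l.length (f a) = fun i => f ((l ++ [a]).getD i d) := by
  funext i
  rcases lt_trichotomy i l.length with h | rfl | h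
  · simp [Function.update, h.ne, List.getElem?_append_left h]
  · simp
  · have h1 : l[i]? = none := List.getElem?_eq_none h.le
    have h2 : (l ++ [a])[i]? = none := List.getElem?_eq_none (by simp; omega)
    simp [Function.update, h.ne', h1, h2]

/-- Cell `0` of array `a`. -/
abbrev Expr.var (a : ℕ) : Expr := .read a (.const 0)

/-- Store the value of `e` in cell `0` of array `a`. -/
abbrev Prog.set (a : ℕ) (e : Expr) : Prog := .assign a (.const 0) e

/-- Decodes the bit string in array `1` into array `3`. -/
def decodeProg : Prog :=
  .loop (.lt (.var 6) (.var 0)) <|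
    .seq (.ite (.read 1 (.var 6))
      (.set 5 (.add (.var 5) (.const 1)))
      (.seq (.assign 3 (.var 4) (.var 5))
        (.seq (.set 4 (.add (.var 4) (.const 1))) (.set 5 (.const 0)))))
    (.set 6 (.add (.var 6) (.const 1)))

/-- Evaluates the coded circuit in array `3`; the values of the wires go to array `7`. -/
def evalProg : Prog :=
  let a : Expr := .read 7 (.read 3 (.add (.var 9) (.const 1)))
  let b : Expr := .read 7 (.read 3 (.add (.var 9) (.const 2)))
  .loop (.lt (.var 9) (.var 4)) <|
    .seq (.assign 10 (.const 1) (.const 1)) <|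
    .seq (.assign 10 (.const 2) (.sub (.const 1) a)) <|
    .seq (.assign 10 (.const 3) (.sub (.add a b) (.const 1))) <|
    .seq (.assign 10 (.const 4) (.lt (.const 0) (.add a b))) <|
    .seq (.assign 10 (.const 5) (.read 2 (.var 8))) <|
    .seq (.assign 7 (.var 8) (.read 10 (.read 3 (.var 9)))) <|
    .seq (.set 8 (.add (.var 8) (.const 1))) (.set 9 (.add (.var 9) (.const 3)))

/-- The verifier: evaluates the coded circuit in array `1` with the witness in array `2`. -/
def verifier : Prog :=
  .seq decodeProg <| .seq evalProg <| .set 0 (.read 7 (.sub (.var 8) (.const 1)))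

theorem decodeProg_runs {L : Set (List Bool)} {ω : ℕ → Bool} (x y : List Bool) :
    Runs L ω decodeProg (pairMemory x y) (x.length * 6 + 1) fun m =>
      m 2 = (fun i => (y.getD i false).toNat) ∧ m 3 = (fun i => (unaryDecode x).getD i 0) ∧
      m 4 0 = (unaryDecode x).length ∧ m 7 = (fun _ => 0) ∧ m 8 0 = 0 ∧ m 9 0 = 0 ∧
      m 10 = fun _ => 0 := by
  have key := Runs.loop_count (L := L) (ω := ω) (e := .lt (.var 6) (.var 0)) (B := 5)
    (p := .seq (.ite (.read 1 (.var 6))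
      (.set 5 (.add (.var 5) (.const 1)))
      (.seq (.assign 3 (.var 4) (.var 5))
        (.seq (.set 4 (.add (.var 4) (.const 1))) (.set 5 (.const 0)))))
      (.set 6 (.add (.var 6) (.const 1))))
    (m := pairMemory x y)
    -- After k rounds, arrays 3, 4 and 5 hold the state of `unaryStep` folded over the first k bits;
    -- the cells needed by `evalProg` are still zero.
    (fun k m => m 0 0 = x.length ∧ m 1 = (fun i => if x.getD i false then 1 else 0) ∧
      m 2 = (fun i => (y.getD i false).toNat) ∧
      m 3 = (fun i => ((x.take k).foldl unaryStep ([], 0)).1.getD i 0) ∧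
      m 4 0 = ((x.take k).foldl unaryStep ([], 0)).1.length ∧
      m 5 0 = ((x.take k).foldl unaryStep ([], 0)).2 ∧ m 6 0 = k ∧
      m 7 = (fun _ => 0) ∧ m 8 0 = 0 ∧ m 9 0 = 0 ∧ m 10 = fun _ => 0) x.length ?_ ?_ ?_
  · refine key.mono le_rfl ?_
    rintro m ⟨-, -, h2, h3, h4, -, -, h7⟩
    rw [List.take_length] at h3 h4
    exact ⟨h2, h3, h4, h7⟩
  · rintro k m hk ⟨h0, h1, h2, h3, h4, h5, h6, h7, h8, h9, h10⟩
    refine ⟨by simp [Expr.eval, h0, h6, hk], ?_⟩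
    have htake : x.take (k + 1) = x.take k ++ [x[k]] := by simp
    obtain ⟨⟨D, c⟩, hD⟩ : ∃ q, (x.take k).foldl unaryStep ([], 0) = q := ⟨_, rfl⟩
    simp only [htake, List.foldl_append, hD, List.foldl_cons, List.foldl_nil] at h3 h4 h5 ⊢
    have hx : (Expr.read 1 (.var 6)).eval m = if x[k] then 1 else 0 := by
      simp [Expr.eval, h6, h1, List.getD_eq_getElem?_getD, List.getElem?_eq_getElem hk]
    refine Runs.mono (Runs.seq (T := 4) (T' := 1) (R := fun m' => (∀ a, a ∉ [3, 4, 5] → m' a = m a) ∧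
      m' 3 = (fun i => (unaryStep (D, c) x[k]).1.getD i 0) ∧
      m' 4 0 = (unaryStep (D, c) x[k]).1.length ∧ m' 5 0 = (unaryStep (D, c) x[k]).2) ?_ ?_)
      le_rfl (fun _ h => h)
    · refine Runs.ite (T := 3) (fun h => ?_) (fun h => ?_)
      · rw [hx] at h
        have hb : x[k] = true := by by_contra hb; simp [hb] at h
        refine Runs.mono (Runs.assign (Q := fun m' => m' = _) rfl) (by norm_num) ?_
        rintro _ rfl
        refine ⟨fun a ha => Memory.write_ne _ _ _ (by simp at ha; tauto), ?_, ?_, ?_⟩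
        · simp [Memory.write_ne, hb, unaryStep, h3]
        · simp [Memory.write_ne, hb, unaryStep, h4]
        · simp [Expr.eval, hb, unaryStep, h5]
      · rw [hx] at h
        have hb : x[k] = false := by by_contra hb; simp [hb] at h
        refine Runs.mono (Runs.assign_seq (Runs.assign_seq
          (Runs.assign (Q := fun m' => m' = _) rfl))) (by norm_num) ?_
        rintro _ rfl
        refine ⟨fun a ha => ?_, ?_, ?_, ?_⟩
        · simp at ha
          rw [Memory.write_ne _ _ _ ha.2.2, Memory.write_ne _ _ _ ha.2.1,
            Memory.write_ne _ _ _ ha.1]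
        · simpa [Memory.write_ne, hb, unaryStep, Expr.eval, h3, h4, h5] using
            update_getD_append id D c 0
        · simp [Memory.write_ne, Expr.eval, hb, unaryStep, h4]
        · simp [Expr.eval, hb, unaryStep]
    · rintro m' ⟨hf, h3', h4', h5'⟩
      refine Runs.assign ?_
      simp [Memory.write_ne, Expr.eval, *]
  · rintro m ⟨h0, -, -, -, -, -, h6, -⟩
    simp [Expr.eval, h0, h6]
  · refine ⟨rfl, rfl, ?_, rfl, rfl, rfl, rfl, rfl, rfl, rfl, rfl⟩
    funext i
    change (if y.getD i false then 1 else 0) = _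
    cases y.getD i false <;> rfl

theorem evalProg_runs {L : Set (List Bool)} {ω : ℕ → Bool} (D : List ℕ) (y : List Bool)
    (m : Memory) (h2 : m 2 = fun i => (y.getD i false).toNat) (h3 : m 3 = fun i => D.getD i 0)
    (h4 : m 4 0 = D.length) (h7 : m 7 = fun _ => 0) (h8 : m 8 0 = 0) (h9 : m 9 0 = 0)
    (h10 : m 10 = fun _ => 0) :
    Runs L ω evalProg m ((D.length + 2) / 3 * 9 + 1) fun m =>
      m 7 = (fun i => ((codeWires D y ((D.length + 2) / 3)).getD i false).toNat) ∧
      m 8 0 = (D.length + 2) / 3 := by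
  unfold evalProg
  -- The number of rounds is a third of the code length, rounded up: an incomplete last gate is
  -- padded with zeros. Wires not yet computed read as `false`, so every code has a meaning and no
  -- syntax check is needed.
  refine Runs.mono (Runs.loop_count (B := 8)
    (fun k m => m 2 = (fun i => (y.getD i false).toNat) ∧ m 3 = (fun i => D.getD i 0) ∧
      m 4 0 = D.length ∧ m 7 = (fun i => ((codeWires D y k).getD i false).toNat) ∧ m 8 0 = k ∧
      m 9 0 = 3 * k ∧ m 10 0 = 0 ∧ ∀ i, 6 ≤ i → m 10 i = 0) ((D.length + 2) / 3) ?_ ?_ ?_) le_rfl ?_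
  · rintro k m hk ⟨h2, h3, h4, h7, h8, h9, h10, h10'⟩
    refine ⟨?_, ?_⟩
    · have : 3 * k < D.length := by omega
      simp [Expr.eval, h4, h9, this]
    · refine Runs.mono (Runs.assign_seq <| Runs.assign_seq <| Runs.assign_seq <|
        Runs.assign_seq <| Runs.assign_seq <| Runs.assign_seq <| Runs.assign_seq <|
        Runs.assign (Q := fun m' => m' = _) rfl) (by norm_num) ?_
      rintro _ rfl
      simp only [Expr.eval, Memory.write_same, ne_eq, Nat.reduceEqDiff, not_false_eq_true,
        Memory.write_ne,
        h2, h3, h4, h7, h8, h9, Function.update_self, true_and, Nat.mul_succ]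
      refine ⟨?_, ?_, ?_⟩
      · rw [codeWires, ← update_getD_append Bool.toNat, length_codeWires]
        congr 1
        -- Array 10 is a table of the values that the gate would have under each of the kinds 1 to
        -- 5, indexed by kind. All its other cells stay zero, matching the default `false` of
        -- `codeGate`.
        generalize D.getD (3 * k) 0 = κ
        rcases κ with _ | _ | _ | _ | _ | _ | κ
        · simp [codeGate, Function.update, h10]
        · simp [codeGate, Function.update]
        · cases h : (codeWires D y k).getD (D.getD (3 * k + 1) 0) false <;>
            simp_all [codeGate, Function.update]
        · cases h : (codeWires D y k).getD (D.getD (3 * k + 1) 0) false <;>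
          cases h' : (codeWires D y k).getD (D.getD (3 * k + 2) 0) false <;>
            simp_all [codeGate, Function.update]
        · cases h : (codeWires D y k).getD (D.getD (3 * k + 1) 0) false <;>
          cases h' : (codeWires D y k).getD (D.getD (3 * k + 2) 0) false <;>
            simp_all [codeGate, Function.update]
        · simp [codeGate, Function.update]
        · simp [codeGate, Function.update, h10']
      · simp [Function.update, h10]
      · intro i hi
        have : i ≠ 1 ∧ i ≠ 2 ∧ i ≠ 3 ∧ i ≠ 4 ∧ i ≠ 5 := by omega
        simp [Function.update, this, h10' i hi]
  · rintro m ⟨-, -, h4, -, -, h9, -⟩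
    have : ¬ 3 * ((D.length + 2) / 3) < D.length := by omega
    simp [Expr.eval, h4, h9, this]
  · exact ⟨h2, h3, h4, by simpa [codeWires] using h7, h8, h9, by simp [h10], by simp [h10]⟩
  · rintro m' ⟨-, -, -, h7, h8, -⟩
    exact ⟨h7, h8⟩

theorem verifier_runs {L : Set (List Bool)} {ω : ℕ → Bool} (x y : List Bool) :
    Runs L ω verifier (pairMemory x y) (20 * (x.length + y.length + 1)) fun m =>
      m 0 0 = (codeAccepts (unaryDecode x) y).toNat := by
  refine Runs.mono (Runs.seq (decodeProg_runs x y) fun m ⟨h2, h3, h4, h7, h8, h9, h10⟩ =>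
    Runs.seq (evalProg_runs _ y m h2 h3 h4 h7 h8 h9 h10) fun m' ⟨h7', h8'⟩ =>
    Runs.assign (Q := fun m => m 0 0 = (codeAccepts (unaryDecode x) y).toNat) ?_) ?_ fun _ h => h
  · simp [Expr.eval, h7', h8', codeAccepts]
  · have := length_unaryDecode_le x
    omega

/-- The oracle language: bit strings that encode a satisfiable circuit. -/
def codeLanguage : Set (List Bool) :=
  {x | ∃ y : List Bool, codeAccepts (unaryDecode x) y = true}

/-- Gate j looks at no witness bit other than bit j. Hence a witness can be cut down to the number
of wires, which gives short witnesses in `codeLanguage_inNP`. -/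
theorem codeWires_take (D : List ℕ) (y : List Bool) {j k : ℕ} (h : j ≤ k) :
    codeWires D (y.take k) j = codeWires D y j := by
  induction j with
  | zero => rfl
  | succ j ih =>
    have hj : (y.take k).getD j false = y.getD j false := by
      simp [List.getD_eq_getElem?_getD, show j < k by omega]
    rw [codeWires, codeWires, ih (by omega), hj]

theorem codeLanguage_inNP : InNP codeLanguage := by
  refine ⟨verifier, 20, fun x y => ?_, fun x => ⟨?_, ?_⟩⟩
  · obtain ⟨m, t, he, ht, -⟩ := verifier_runs (L := ∅) (ω := fun _ => false) x y 0
    exact ⟨_, t, he, ht.trans (Nat.mul_le_mul_left _ (Nat.le_self_pow (by norm_num) _))⟩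
  · rintro ⟨y, hy⟩
    obtain ⟨m, t, he, -, hm⟩ := verifier_runs (L := ∅) (ω := fun _ => false) x (y.take x.length) 0
    refine ⟨y.take x.length, ?_, _, t, he, ?_⟩
    · calc (y.take x.length).length ≤ x.length + 1 := by simp
        _ ≤ (x.length + 1) ^ 20 := Nat.le_self_pow (by norm_num) _
        _ ≤ 20 * (x.length + 1) ^ 20 := Nat.le_mul_of_pos_left _ (by norm_num)
    · have := length_unaryDecode_le x
      change m 0 0 ≠ 0
      rw [hm, codeAccepts, codeWires_take _ _ (by omega), ← codeAccepts, hy]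
      exact one_ne_zero
  · rintro ⟨y, -, s, t, he, hs⟩
    obtain ⟨m, t', he', -, hm⟩ := verifier_runs (L := ∅) (ω := fun _ => false) x y 0
    -- The given accepting run is arbitrary; determinism identifies it with the run that was
    -- analysed.
    obtain ⟨rfl, -⟩ := he.deterministic he'
    refine ⟨y, ?_⟩
    by_contra h
    exact hs (by simp [hm, h])

/-! ### Coded circuits -/

/-- The code of a list of gates, each given by its kind and its entering wires. -/
def flatten (τ : List (ℕ × ℕ × ℕ)) : List ℕ :=
  τ.flatMap fun t => [t.1, t.2.1, t.2.2]

theorem flatten_append (τ τ' : List (ℕ × ℕ × ℕ)) : flatten (τ ++ τ') = flatten τ ++ flatten τ' := by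
  simp [flatten]

theorem length_flatten (τ : List (ℕ × ℕ × ℕ)) : (flatten τ).length = 3 * τ.length := by
  induction τ with
  | nil => rfl
  | cons t τ ih =>
    rw [← List.singleton_append, flatten_append, List.length_append, ih]
    simp [flatten]
    omega

/-- The values of all wires of the circuit with the list of gates `τ`, with witness `y`. -/
def wiresOf (τ : List (ℕ × ℕ × ℕ)) (y : List Bool) : List Bool :=
  codeWires (flatten τ) y τ.length

theorem codeWires_append (D D' : List ℕ) (y : List Bool) {j : ℕ} (h : 3 * j ≤ D.length) :
    codeWires (D ++ D') y j = codeWires D y j := by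
  induction j with
  | zero => rfl
  | succ j ih =>
    have hD : ∀ i < D.length, (D ++ D').getD i 0 = D.getD i 0 := fun i hi => by
      simp [List.getD_eq_getElem?_getD, List.getElem?_append_left hi]
    rw [codeWires, codeWires, ih (by omega), hD _ (by omega), hD _ (by omega), hD _ (by omega)]

theorem wiresOf_append_singleton (τ : List (ℕ × ℕ × ℕ)) (t : ℕ × ℕ × ℕ) (y : List Bool) :
    wiresOf (τ ++ [t]) y = wiresOf τ y ++
      [codeGate (fun u => (wiresOf τ y).getD u false) (y.getD τ.length false) t.1 t.2.1 t.2.2] := by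
  have hl := length_flatten τ
  have hD : ∀ i, (flatten τ ++ flatten [t]).getD (3 * τ.length + i) 0 = (flatten [t]).getD i 0 :=
    fun i => by
      rw [List.getD_eq_getElem?_getD, List.getElem?_append_right (by omega), hl,
        Nat.add_sub_cancel_left, ← List.getD_eq_getElem?_getD]
  unfold wiresOf
  rw [List.length_append, List.length_singleton, codeWires, flatten_append,
    codeWires_append _ _ _ hl.ge, hD 1, hD 2]
  have h0 := hD 0
  rw [add_zero] at h0
  rw [h0]
  rfl

theorem codeAccepts_flatten_append_singleton (τ : List (ℕ × ℕ × ℕ)) (t : ℕ × ℕ × ℕ)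
    (y : List Bool) : codeAccepts (flatten (τ ++ [t])) y =
      codeGate (fun u => (wiresOf τ y).getD u false) (y.getD τ.length false) t.1 t.2.1 t.2.2 := by
  have h : ((flatten (τ ++ [t])).length + 2) / 3 = (τ ++ [t]).length := by
    rw [length_flatten]; omega
  have hl : (wiresOf τ y).length = τ.length := length_codeWires _ _ _
  rw [codeAccepts, h, ← wiresOf, wiresOf_append_singleton]
  simp [← hl]

theorem codeGate_kind (w : ℕ → Bool) (b : Bool) (g : Gate) :
    codeGate w b g.kind g.fst g.snd = g.eval w := by
  rcases g with (_ | _) | _ | _ | _ <;> rfl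

/-- Input wire `i` carries a witness bit if `i ∈ T`, and `false` otherwise. -/
def inputCode (T : Finset ℕ) (i : ℕ) : ℕ × ℕ × ℕ :=
  (if i ∈ T then 5 else 0, 0, 0)

/-- The kind and the entering wires of a gate. -/
def gateCode (g : Gate) : ℕ × ℕ × ℕ :=
  (g.kind, g.fst, g.snd)

theorem wiresOf_inputs (T : Finset ℕ) (y : List Bool) (k : ℕ) :
    wiresOf ((List.range k).map (inputCode T)) y =
      (List.range k).map fun i => decide (i ∈ T) && y.getD i false := by
  induction k with
  | zero => rfl
  | succ k ih =>
    rw [List.range_succ, List.map_append, List.map_append, List.map_singleton,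
      wiresOf_append_singleton, ih, List.length_map, List.length_range]
    by_cases h : k ∈ T <;> simp [inputCode, h, codeGate]

theorem wiresOf_gates (τ : List (ℕ × ℕ × ℕ)) (gs : List Gate) (y : List Bool) :
    wiresOf (τ ++ gs.map gateCode) y =
      gs.foldl (fun v g => v ++ [g.eval fun u => v.getD u false]) (wiresOf τ y) := by
  induction gs using List.reverseRecOn with
  | nil => simp
  | append_singleton gs g ih =>
    rw [List.map_append, List.map_singleton, ← List.append_assoc, wiresOf_append_singleton, ih,
      List.foldl_append]
    simp only [gateCode, codeGate_kind, List.foldl_cons, List.foldl_nil]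

/-- The value of the circuit at the indicator vector of a set. -/
def Circuit.evalSet {n : ℕ} (C : Circuit n) (Y : Finset ℕ) : Bool :=
  C.eval fun i => decide ((i : ℕ) ∈ Y)

/-- Code of a circuit that is satisfiable if and only if `C` takes a value other than `b` at the
indicator vector of a subset of `T`. -/
def circuitCode {n : ℕ} (C : Circuit n) (T : Finset ℕ) (b : Bool) : List (ℕ × ℕ × ℕ) :=
  (List.range n).map (inputCode T) ++ C.gates.map gateCode ++
    [(4 - b.toNat - b.toNat, C.output, C.output)]

theorem codeAccepts_circuitCode {n : ℕ} (C : Circuit n) (T : Finset ℕ) (b : Bool) (y : List Bool) :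
    codeAccepts (flatten (circuitCode C T b)) y = true ↔
      C.eval (fun i => decide ((i : ℕ) ∈ T) && y.getD i false) ≠ b := by
  have hw : wiresOf ((List.range n).map (inputCode T) ++ C.gates.map gateCode) y =
      C.wires fun i => decide ((i : ℕ) ∈ T) && y.getD i false := by
    rw [wiresOf_gates, wiresOf_inputs, Circuit.wires]
    congr 1
    apply List.ext_getElem <;> simp
  rw [circuitCode, codeAccepts_flatten_append_singleton, hw, Circuit.eval]
  -- The last gate has kind 4 for b = `false`, the disjunction of the output with itself, and kind 2
  -- for b = `true`, its negation.
  cases b <;> simp [codeGate]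

theorem exists_codeAccepts_circuitCode {n : ℕ} (C : Circuit n) {T : Finset ℕ} (b : Bool) :
    (∃ y, codeAccepts (flatten (circuitCode C T b)) y = true) ↔ ∃ Y ⊆ T, C.evalSet Y ≠ b := by
  simp only [codeAccepts_circuitCode]
  constructor
  · rintro ⟨y, hy⟩
    refine ⟨T.filter fun i => y.getD i false = true, Finset.filter_subset _ _, ?_⟩
    simpa [Circuit.evalSet] using hy
  · rintro ⟨Y, hYT, hY⟩
    refine ⟨(List.range n).map fun i => decide (i ∈ Y), ?_⟩
    convert hY using 1
    refine congrArg C.eval (funext fun i => ?_)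
    by_cases h : (i : ℕ) ∈ Y
    · simp [h, hYT h]
    · simp [h]

/-- Kinds are at most 5, and well-formedness bounds the wires. This controls both the length of the
unary query and the time to write it. -/
theorem le_of_mem_circuitCode {n : ℕ} (C : Circuit n) (T : Finset ℕ) (b : Bool) :
    ∀ t ∈ circuitCode C T b,
      t.1 ≤ n + C.size + 5 ∧ t.2.1 ≤ n + C.size + 5 ∧ t.2.2 ≤ n + C.size + 5 := by
  intro t ht
  simp only [circuitCode, List.mem_append, List.mem_map, List.mem_singleton] at ht
  rcases ht with (⟨i, -, rfl⟩ | ⟨g, hg, rfl⟩) | rfl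
  · simp only [inputCode]; split_ifs <;> omega
  · obtain ⟨j, hj, rfl⟩ := List.getElem_of_mem hg
    have := C.wf j hj
    unfold Circuit.size
    revert this
    rcases C.gates[j] with (_ | _) | _ | _ | _ <;>
      simp only [Gate.Below, gateCode, Gate.kind, Gate.fst, Gate.snd] <;> omega
  · have := C.output_lt
    unfold Circuit.size
    simp only
    omega

/-! ### The query subroutine -/

/-- Appends the unary code of `e` to the bit string in array `8`, whose length is in array `9`. -/
def pushProg (e : Expr) : Prog :=
  .seq (.set 13 e) <|
  .seq (.loop (.var 13) <|
    .seq (.assign 8 (.var 9) (.const 1)) <|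
    .seq (.set 9 (.add (.var 9) (.const 1))) (.set 13 (.sub (.var 13) (.const 1)))) <|
  .seq (.assign 8 (.var 9) (.const 0)) (.set 9 (.add (.var 9) (.const 1)))

theorem pushProg_runs {L : Set (List Bool)} {ω : ℕ → Bool} (e : Expr) (m : Memory) :
    Runs L ω (pushProg e) m (4 * e.eval m + 4) fun m' => (∀ a ∉ [8, 9, 13], m' a = m a) ∧
      m'.bits 8 (m' 9 0) = m.bits 8 (m 9 0) ++ unary [e.eval m] := by
  refine Runs.mono (Runs.assign_seq <| Runs.seq
    (Runs.loop_count (B := 3) (fun k m' => (∀ a ∉ [8, 9, 13], m' a = m a) ∧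
      m' 13 0 = e.eval m - k ∧
      m'.bits 8 (m' 9 0) = m.bits 8 (m 9 0) ++ List.replicate k true) (e.eval m) ?_ ?_ ?_)
    fun m' h => Runs.assign_seq <| Runs.assign (Q := fun m' => (∀ a ∉ [8, 9, 13], m' a = m a) ∧
      m'.bits 8 (m' 9 0) = m.bits 8 (m 9 0) ++ unary [e.eval m]) ?_) (by omega) (fun _ h => h)
  · rintro k m' hk ⟨hf, h13, hb⟩
    refine ⟨by simp [Expr.eval, h13]; omega, ?_⟩
    refine Runs.mono (Runs.assign_seq <| Runs.assign_seq <|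
        Runs.assign (Q := fun m' => m' = _) rfl) (by norm_num) ?_
    rintro _ rfl
    refine ⟨fun a ha => ?_, ?_, ?_⟩
    · rw [← hf a ha]
      simp at ha
      simp [Memory.write_ne, ha]
    · simp [Memory.write_ne, Expr.eval, h13]; omega
    · have h := Memory.bits_write_succ m' 8 (m' 9 0) 1
      rw [hb] at h
      rw [List.replicate_succ', ← List.append_assoc]
      simp [Memory.write_ne, Expr.eval, Memory.bits] at h ⊢
      exact h
  · rintro m' ⟨-, h13, -⟩
    simp [Expr.eval, h13]
  · refine ⟨fun a ha => ?_, ?_, ?_⟩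
    · simp at ha
      simp [Memory.write_ne, ha]
    · simp [Expr.eval]
    · simp [Memory.write_ne, Memory.bits]
  · obtain ⟨hf, -, hb⟩ := h
    refine ⟨fun a ha => ?_, ?_⟩
    · rw [← hf a ha]
      simp at ha
      simp [Memory.write_ne, ha]
    · have h := Memory.bits_write_succ m' 8 (m' 9 0) 0
      rw [hb] at h
      simp [Memory.write_ne, Expr.eval, unary, Memory.bits] at h ⊢
      exact h

/-- Appends the unary codes of three numbers to the bit string in array `8`. -/
def pushGateProg (e₁ e₂ e₃ : Expr) : Prog :=
  .seq (pushProg e₁) <| .seq (pushProg e₂) (pushProg e₃)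

/-- The later expressions are evaluated after earlier pushes have changed arrays 8, 9 and 13, so
`he` asks for their values in every memory that differs only there. -/
theorem pushGateProg_runs {L : Set (List Bool)} {ω : ℕ → Bool} {e₁ e₂ e₃ : Expr} {m : Memory}
    {t : ℕ × ℕ × ℕ} {M : ℕ} (ht : t.1 ≤ M ∧ t.2.1 ≤ M ∧ t.2.2 ≤ M)
    (he : ∀ m' : Memory, (∀ a ∉ [8, 9, 13], m' a = m a) →
      e₁.eval m' = t.1 ∧ e₂.eval m' = t.2.1 ∧ e₃.eval m' = t.2.2) :
    Runs L ω (pushGateProg e₁ e₂ e₃) m (12 * M + 12) fun m' => (∀ a ∉ [8, 9, 13], m' a = m a) ∧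
      m'.bits 8 (m' 9 0) = m.bits 8 (m 9 0) ++ unary (flatten [t]) := by
  have key : ∀ (e : Expr) (k : ℕ) (ks : List ℕ) (m₁ : Memory), k ≤ M → e.eval m₁ = k →
      (∀ a ∉ [8, 9, 13], m₁ a = m a) → m₁.bits 8 (m₁ 9 0) = m.bits 8 (m 9 0) ++ unary ks →
      Runs L ω (pushProg e) m₁ (4 * M + 4) fun m' => (∀ a ∉ [8, 9, 13], m' a = m a) ∧
        m'.bits 8 (m' 9 0) = m.bits 8 (m 9 0) ++ unary (ks ++ [k]) := by
    intro e k ks m₁ hk hek hf hb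
    refine (pushProg_runs e m₁).mono (by omega) fun m' ⟨hf', hb'⟩ => ⟨fun a ha => ?_, ?_⟩
    · rw [hf' a ha, hf a ha]
    · rw [hb', hb, hek, unary_append, List.append_assoc]
  refine Runs.mono (Runs.seq (key e₁ _ [] m ht.1 (he m fun _ _ => rfl).1 (fun _ _ => rfl)
    (by simp [unary])) fun m₁ ⟨hf₁, hb₁⟩ =>
    Runs.seq (key e₂ _ _ m₁ ht.2.1 (he m₁ hf₁).2.1 hf₁ hb₁) fun m₂ ⟨hf₂, hb₂⟩ =>
    key e₃ _ _ m₂ ht.2.2 (he m₂ hf₂).2.2 hf₂ hb₂) (by omega) fun _ h => h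

/-- Appends the codes of `N` gates, where `N` is in array `a`; the expressions may refer to the
index of the gate, which is in array `12`. -/
def pushGatesProg (a : ℕ) (e₁ e₂ e₃ : Expr) : Prog :=
  .seq (.set 12 (.const 0)) <|
  .loop (.lt (.var 12) (.var a)) <|
    .seq (pushGateProg e₁ e₂ e₃) (.set 12 (.add (.var 12) (.const 1)))

theorem pushGatesProg_runs {L : Set (List Bool)} {ω : ℕ → Bool} {a N M : ℕ} {e₁ e₂ e₃ : Expr}
    {m : Memory} (τ : ℕ → ℕ × ℕ × ℕ) (ha : a ∉ [8, 9, 12, 13]) (hN : m a 0 = N)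
    (hτ : ∀ i < N, (τ i).1 ≤ M ∧ (τ i).2.1 ≤ M ∧ (τ i).2.2 ≤ M)
    (he : ∀ i < N, ∀ m' : Memory, (∀ a ∉ [8, 9, 12, 13], m' a = m a) → m' 12 0 = i →
      e₁.eval m' = (τ i).1 ∧ e₂.eval m' = (τ i).2.1 ∧ e₃.eval m' = (τ i).2.2) :
    Runs L ω (pushGatesProg a e₁ e₂ e₃) m (N * (12 * M + 14) + 2) fun m' =>
      (∀ a ∉ [8, 9, 12, 13], m' a = m a) ∧
      m'.bits 8 (m' 9 0) = m.bits 8 (m 9 0) ++ unary (flatten ((List.range N).map τ)) := by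
  refine Runs.mono (Runs.assign_seq <| Runs.loop_count (B := 12 * M + 12 + 1)
    (fun k m' => (∀ a ∉ [8, 9, 12, 13], m' a = m a) ∧ m' 12 0 = k ∧
      m'.bits 8 (m' 9 0) = m.bits 8 (m 9 0) ++ unary (flatten ((List.range k).map τ))) N ?_ ?_ ?_)
    (by rw [show 12 * M + 12 + 1 + 1 = 12 * M + 14 from rfl]; omega) fun m' h => ⟨h.1, h.2.2⟩
  · rintro k m' hk ⟨hf, h12, hb⟩
    refine ⟨by simp [Expr.eval, h12, hf a ha, hN, hk], ?_⟩
    refine Runs.seq (pushGateProg_runs (hτ k hk) fun m₁ hm₁ => he k hk m₁ (fun a' ha' =>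
      (hm₁ a' (by simp at ha' ⊢; tauto)).trans (hf a' ha')) ?_) fun m₁ ⟨hf₁, hb₁⟩ =>
      Runs.assign ⟨fun a' ha' => ?_, ?_, ?_⟩
    · rw [hm₁ 12 (by decide), h12]
    · rw [← hf a' ha', ← hf₁ a' (by simp at ha' ⊢; tauto)]
      simp at ha'
      simp [Memory.write_ne, ha']
    · simp [Expr.eval, hf₁ 12 (by decide), h12]
    · rw [Memory.write_ne _ _ _ (by decide), Memory.bits_congr (Memory.write_ne _ _ _ (by decide)),
        hb₁, hb, List.range_succ, List.map_append, flatten_append, unary_append, List.append_assoc,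
        List.map_singleton]
  · rintro m' ⟨hf, h12, -⟩
    simp [Expr.eval, h12, hf a ha, hN]
  · refine ⟨fun a ha => ?_, by simp [Expr.eval], ?_⟩
    · simp at ha
      simp [Memory.write_ne, ha]
    · simp [Memory.write_ne, Memory.bits, unary, flatten]

/-- The indicator function of a set. -/
def ind (T : Finset ℕ) (i : ℕ) : ℕ := if i ∈ T then 1 else 0

/-- The memory of the algorithm: the circuit `C`, the set `S` of variables that are fixed so far, the
set `T` of variables that are free in the next query, and the value `b`. -/
structure Holds {n : ℕ} (C : Circuit n) (S T : Finset ℕ) (b : Bool) (m : Memory) : Prop where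
  fixed : m 0 = ind S
  kind : m 1 = fun j => (C.gates.map Gate.kind).getD j 0
  fst : m 2 = fun j => (C.gates.map Gate.fst).getD j 0
  snd : m 3 = fun j => (C.gates.map Gate.snd).getD j 0
  inputs : m 4 0 = n
  size : m 5 0 = C.size
  output : m 6 0 = C.output
  free : m 7 = ind T
  value : m 11 0 = b.toNat

/-- The listed arrays are scratch space: the query string and its length (8, 9), the answer (10) and
loop counters (12, 13, 14). -/
theorem Holds.congr {n : ℕ} {C : Circuit n} {S T : Finset ℕ} {b : Bool} {m m' : Memory}
    (h : Holds C S T b m) (hm : ∀ a ∉ [8, 9, 10, 12, 13, 14], m' a = m a) : Holds C S T b m' := by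
  obtain ⟨h0, h1, h2, h3, h4, h5, h6, h7, h11⟩ := h
  constructor <;> rwa [hm _ (by decide)]

/-- Asks the oracle whether `C` takes a value other than `b` at the indicator vector of a subset of
`T`; the answer goes to array `10`. -/
def queryProg : Prog :=
  let r : Expr := .read 7 (.var 12)
  .seq (.set 9 (.const 0)) <|
  .seq (pushGatesProg 4 (.add r (.add r (.add r (.add r r)))) (.const 0) (.const 0)) <|
  .seq (pushGatesProg 5 (.read 1 (.var 12)) (.read 2 (.var 12)) (.read 3 (.var 12))) <|
  .seq (pushGateProg (.sub (.sub (.const 4) (.var 11)) (.var 11)) (.var 6) (.var 6)) <|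
  .query 8 (.var 9) 10

open Classical in
theorem queryProg_runs {ω : ℕ → Bool} {n : ℕ} {C : Circuit n} {S T : Finset ℕ} {b : Bool}
    {m : Memory} (h : Holds C S T b m) :
    Runs codeLanguage ω queryProg m (200 * (n + C.size + 1) ^ 2) fun m' =>
      (∀ a ∉ [8, 9, 10, 12, 13], m' a = m a) ∧
      m' 10 0 = if ∃ Y ⊆ T, C.evalSet Y ≠ b then 1 else 0 := by
  have hM := le_of_mem_circuitCode C T b
  have hgates : (List.range C.size).map (fun j => ((C.gates.map Gate.kind).getD j 0,
      (C.gates.map Gate.fst).getD j 0, (C.gates.map Gate.snd).getD j 0)) =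
      C.gates.map gateCode := by
    apply List.ext_getElem
    · simp [Circuit.size]
    · intro i h₁ h₂
      have hi : i < C.gates.length := by simpa using h₂
      simp [gateCode, hi]
  unfold queryProg
  refine Runs.mono (Runs.assign_seq <| Runs.seq (pushGatesProg_runs (N := n) (M := n + C.size + 5)
    (inputCode T) (by decide) ?_ ?_ ?_) fun m₁ ⟨hf₁, hb₁⟩ =>
    Runs.seq (pushGatesProg_runs (N := C.size) (M := n + C.size + 5)
      (fun j => ((C.gates.map Gate.kind).getD j 0, (C.gates.map Gate.fst).getD j 0,
        (C.gates.map Gate.snd).getD j 0)) (by decide) ?_ ?_ ?_) fun m₂ ⟨hf₂, hb₂⟩ =>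
    Runs.seq (R := fun m₃ => (∀ a ∉ [8, 9, 10, 12, 13], m₃ a = m a) ∧
        m₃.bits 8 (m₃ 9 0) = unary (flatten (circuitCode C T b)))
      (Runs.mono (pushGateProg_runs (M := n + C.size + 5)
        (t := (4 - b.toNat - b.toNat, C.output, C.output)) ?_ ?_) le_rfl ?_) fun m₃ ⟨hf₃, hb₃⟩ =>
    Runs.mono (Runs.query (Q := fun m' => (∀ a ∉ [8, 9, 10, 12, 13], m' a = m a) ∧
      m' 10 0 = if ∃ Y ⊆ T, C.evalSet Y ≠ b then 1 else 0) ?_)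
      (T' := 3 * (n + C.size + 1) * (n + C.size + 6) + 1) ?_ fun _ h => h) ?_ fun _ h => h
  · rw [Memory.write_ne _ _ _ (by decide), h.inputs]
  · exact fun i hi => hM _ (by simp [circuitCode]; exact Or.inl ⟨i, hi, rfl⟩)
  · intro i hi m' hm' h12
    have h7 : m' 7 = ind T := by
      rw [hm' 7 (by decide), Memory.write_ne _ _ _ (by decide), h.free]
    -- Without multiplication, the kind 5 or 0 of an input is the indicator of T added five times.
    by_cases hT : i ∈ T <;> simp [Expr.eval, h12, h7, ind, inputCode, hT]
  · rw [hf₁ 5 (by decide), Memory.write_ne _ _ _ (by decide), h.size]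
  · intro i hi
    refine hM _ ?_
    rw [circuitCode, ← hgates]
    exact List.mem_append_left _ (List.mem_append_right _
      (List.mem_map.2 ⟨i, List.mem_range.2 hi, rfl⟩))
  · intro i hi m' hm' h12
    have hm : ∀ a ∉ [8, 9, 12, 13], m' a = m a := fun a ha => by
      rw [hm' a ha, hf₁ a ha, Memory.write_ne _ _ _ (by rintro rfl; simp at ha)]
    simp [Expr.eval, h12, hm, h.kind, h.fst, h.snd]
  · exact hM _ (by simp [circuitCode])
  · intro m' hm'
    have hm : ∀ a ∉ [8, 9, 12, 13], m' a = m a := fun a ha => by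
      rw [hm' a (by simp at ha ⊢; tauto), hf₂ a ha, hf₁ a ha,
        Memory.write_ne _ _ _ (by rintro rfl; simp at ha)]
    simp [Expr.eval, hm, h.output, h.value]
  · rintro m₃ ⟨hf₃, hb₃⟩
    constructor
    · intro a ha
      rw [hf₃ a (by simp at ha ⊢; tauto), hf₂ a (by simp at ha ⊢; tauto),
        hf₁ a (by simp at ha ⊢; tauto), Memory.write_ne _ _ _ (by rintro rfl; simp at ha)]
    · rw [hb₃, hb₂, hb₁, hgates, circuitCode, flatten_append, flatten_append, unary_append,
        unary_append]
      simp [Expr.eval, Memory.bits]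
  · constructor
    · intro a ha
      rw [Memory.write_ne _ _ _ (by rintro rfl; simp at ha), hf₃ a ha]
    · have : (Expr.var 9).eval m₃ = m₃ 9 0 := rfl
      rw [this, hb₃, Memory.write_same, Function.update_self]
      refine if_congr ?_ rfl rfl
      rw [← exists_codeAccepts_circuitCode, codeLanguage, Set.mem_ofPred_eq, unaryDecode_unary]
  -- The query costs the length of its string: three numbers per gate, each at most n + `C.size` + 5
  -- ones and a zero.
  · have hlen : m₃ 9 0 = (unary (flatten (circuitCode C T b))).length := by
      rw [← hb₃, Memory.bits_length]
    have hle := length_unary_le (ks := flatten (circuitCode C T b)) (M := n + C.size + 5) (by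
      intro k hk
      simp only [flatten, List.mem_flatMap, List.mem_cons, List.not_mem_nil, or_false] at hk
      obtain ⟨t, ht, rfl | rfl | rfl⟩ := hk
      exacts [(hM t ht).1, (hM t ht).2.1, (hM t ht).2.2])
    have hc : (circuitCode C T b).length = n + C.size + 1 := by
      simp [circuitCode, Circuit.size, add_assoc]
    rw [length_flatten, hc] at hle
    change m₃ 9 0 + 1 ≤ _
    rw [hlen]
    exact Nat.succ_le_succ hle
  · nlinarith

/-! ### Sensitive blocks and certificates -/

theorem exists_certificate_card_le {n : ℕ} (f : (Fin n → Bool) → Bool) (x : Fin n → Bool) :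
    ∃ Z : Finset (Fin n), IsCertificate f x Z ∧ Z.card ≤ cert f := by
  have hne : {k : ℕ | ∃ S : Finset (Fin n), IsCertificate f x S ∧ S.card = k}.Nonempty :=
    ⟨_, Finset.univ, fun y hy => congrArg f (funext fun i => hy i (Finset.mem_univ i)), rfl⟩
  obtain ⟨Z, hZ, hc⟩ := Nat.sInf_mem hne
  exact ⟨Z, hZ, hc.trans_le (Finset.le_sup (f := certAt f) (Finset.mem_univ x))⟩

namespace Circuit

variable {n : ℕ} (C : Circuit n)

/-- A set of sensitive coordinates is contained in every certificate. -/
theorem card_le_cert_of_sensitive {T : Finset ℕ}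
    (h : ∀ i ∈ T, C.evalSet (T.erase i) ≠ C.evalSet T) : T.card ≤ cert C.eval := by
  obtain ⟨Z, hZ, hc⟩ := exists_certificate_card_le C.eval fun i => decide ((i : ℕ) ∈ T)
  refine le_trans ?_ hc
  rw [← Finset.card_map Fin.valEmbedding]
  refine Finset.card_le_card fun i hi => ?_
  -- If i is not in Z, then erasing i from T alters no coordinate in Z, so the value cannot change.
  by_contra hiZ
  refine h i hi (hZ _ fun j hj => ?_)
  have : (j : ℕ) ≠ i := by
    rintro rfl
    exact hiZ (Finset.mem_map_of_mem _ hj)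
  simp [this]

/-- A certificate at the zero vector meets all sensitive blocks. -/
theorem exists_hitting_set : ∃ Z : Finset ℕ, Z.card ≤ cert C.eval ∧
    ∀ T : Finset ℕ, C.evalSet T ≠ C.evalSet ∅ → (T ∩ Z).Nonempty := by
  obtain ⟨Z, hZ, hc⟩ := exists_certificate_card_le C.eval fun i => decide ((i : ℕ) ∈ (∅ : Finset ℕ))
  refine ⟨Z.map Fin.valEmbedding, by rwa [Finset.card_map], fun T hT => ?_⟩
  rw [Finset.nonempty_iff_ne_empty]
  intro hTZ
  refine hT (hZ _ fun j hj => ?_)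
  have : (j : ℕ) ∉ T := fun hjT =>
    (Finset.eq_empty_iff_forall_notMem.1 hTZ) j
      (Finset.mem_inter.2 ⟨hjT, Finset.mem_map_of_mem Fin.valEmbedding hj⟩)
  simp [this]

end Circuit

theorem outputRestriction_length_eq {n : ℕ} {S : Finset ℕ} (hS : S ⊆ Finset.range n) {m : Memory}
    (hm : m 0 = ind S) : (outputRestriction n m).length = S.card := by
  rw [Restriction.length, ← Finset.card_map Fin.valEmbedding]
  congr 1
  ext i
  simp only [outputRestriction, hm, ind, Finset.mem_map, Finset.mem_filter, Finset.mem_univ,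
    true_and, Fin.valEmbedding_apply]
  constructor
  · rintro ⟨j, hj, rfl⟩
    by_contra h
    simp [h] at hj
  · exact fun hi => ⟨⟨i, Finset.mem_range.1 (hS hi)⟩, by simp [hi], rfl⟩

/-- The entry 1 fixes a variable to `false`, so the restricted function only sees indicator vectors
of sets disjoint from S. -/
theorem isConstant_restrict_outputRestriction {n : ℕ} (C : Circuit n) {S : Finset ℕ} {m : Memory}
    {b : Bool} (hm : m 0 = ind S) (hb : ∀ Y ⊆ Finset.range n \ S, C.evalSet Y = b) :
    IsConstant (restrict C.eval (outputRestriction n m)) := by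
  refine ⟨b, fun x => ?_⟩
  rw [← hb ((Finset.range n \ S).filter fun i => ∃ h : i < n, x ⟨i, h⟩ = true)
    (Finset.filter_subset _ _)]
  refine congrArg C.eval (funext fun i => ?_)
  by_cases h : (i : ℕ) ∈ S <;> simp [outputRestriction, hm, ind, h]

/-! ### The algorithm -/

/-- Moves `T` to `S`, and sets `T` to the set of the remaining variables. -/
def updateProg : Prog :=
  .seq (.set 14 (.const 0)) <|
  .loop (.lt (.var 14) (.var 4)) <|
    .seq (.assign 0 (.var 14) (.add (.read 0 (.var 14)) (.read 7 (.var 14)))) <|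
    .seq (.assign 7 (.var 14) (.sub (.const 1) (.read 0 (.var 14))))
      (.set 14 (.add (.var 14) (.const 1)))

theorem updateProg_runs {L : Set (List Bool)} {ω : ℕ → Bool} {n : ℕ} {C : Circuit n}
    {S T : Finset ℕ} {b : Bool} {m : Memory} (h : Holds C S T b m)
    (hT : T ⊆ Finset.range n) (hST : Disjoint S T) :
    Runs L ω updateProg m (n * 4 + 2) (Holds C (S ∪ T) (Finset.range n \ (S ∪ T)) b) := by
  have hdisj : ∀ i ∈ S, i ∉ T := fun i hi => Finset.disjoint_left.1 hST hi
  refine Runs.mono (Runs.assign_seq <| Runs.loop_count (B := 3)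
    -- The cells below k are already updated. Since S and T are disjoint, the sums written to array
    -- 0 are at most 1.
    (fun k m' => Holds C (S ∪ T.filter (· < k))
      ((Finset.range n).filter fun i => if i < k then i ∉ S ∪ T else i ∈ T) b m' ∧ m' 14 0 = k)
    n ?_ ?_ ?_) (by omega) ?_
  · rintro k m' hk ⟨hm', h14⟩
    refine ⟨by simp [Expr.eval, hm'.inputs, h14, hk], ?_⟩
    obtain ⟨h0, h1, h2, h3, h4, h5, h6, h7, h11⟩ := hm'
    refine Runs.mono (Runs.assign_seq <| Runs.assign_seq <|
      Runs.assign (Q := fun m' => m' = _) rfl) (by norm_num) ?_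
    rintro _ rfl
    refine ⟨⟨?_, ?_, ?_, ?_, ?_, ?_, ?_, ?_, ?_⟩, ?_⟩
    · funext i
      simp only [Expr.eval, Memory.write_same, ne_eq, Nat.reduceEqDiff, not_false_eq_true,
        Memory.write_ne, h0, h7, h14, OfNat.zero_ne_ofNat]
      rcases eq_or_ne i k with rfl | hik
      · simp only [Function.update_self, ind]
        by_cases hi : i ∈ S
        · simp [hi, hk, hdisj i hi]
        · simp [hi, hk]
      · simp only [Function.update_of_ne hik, ind]
        refine if_congr ?_ rfl rfl
        simp only [Finset.mem_union, Finset.mem_filter]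
        have : i < k + 1 ↔ i < k := by omega
        rw [this]
    · simpa [Memory.write_ne] using h1
    · simpa [Memory.write_ne] using h2
    · simpa [Memory.write_ne] using h3
    · simpa [Memory.write_ne] using h4
    · simpa [Memory.write_ne] using h5
    · simpa [Memory.write_ne] using h6
    · funext i
      simp only [Expr.eval, Memory.write_same, ne_eq, Nat.reduceEqDiff, not_false_eq_true,
        Memory.write_ne, h0, h7, h14, OfNat.ofNat_ne_zero]
      rcases eq_or_ne i k with rfl | hik
      · simp only [Function.update_self, ind]
        by_cases hi : i ∈ S
        · simp [hi, hk]
        · by_cases hi' : i ∈ T <;> simp [hi, hk, hi']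
      · simp only [Function.update_of_ne hik, ind]
        refine if_congr ?_ rfl rfl
        have : i < k + 1 ↔ i < k := by omega
        simp only [Finset.mem_filter, this]
    · simpa [Memory.write_ne] using h11
    · simp [Expr.eval, Memory.write_ne, h14]
  · rintro m' ⟨hm', h14⟩
    simp [Expr.eval, hm'.inputs, h14]
  · have hT' : (Finset.range n).filter (fun i => if i < 0 then i ∉ S ∪ T else i ∈ T) = T := by
      ext i
      simpa using fun hi => Finset.mem_range.1 (hT hi)
    rw [hT']
    refine ⟨?_, by simp [Expr.eval]⟩
    simpa using h.congr fun a ha => Memory.write_ne _ _ _ (by rintro rfl; simp at ha)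
  · rintro m' ⟨hfinal, -⟩
    have h1 : T.filter (· < n) = T := Finset.filter_true_of_mem fun i hi => Finset.mem_range.1 (hT hi)
    have h2 : (Finset.range n).filter (fun i => if i < n then i ∉ S ∪ T else i ∈ T) =
        Finset.range n \ (S ∪ T) := by
      ext i
      simp only [Finset.mem_filter, Finset.mem_range, Finset.mem_sdiff]
      constructor <;> rintro ⟨hi, hi'⟩ <;> simp_all
    rwa [h1, h2] at hfinal

/-- Shrinks `T` to a minimal sensitive block. -/
def shrinkProg : Prog :=
  .seq (.set 14 (.const 0)) <|
  .loop (.lt (.var 14) (.var 4)) <|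
    .seq (.assign 7 (.var 14) (.const 0)) <|
    .seq queryProg <|
    .seq (.assign 7 (.var 14) (.sub (.const 1) (.var 10)))
      (.set 14 (.add (.var 14) (.const 1)))

theorem Holds.setFree {n : ℕ} {C : Circuit n} {S T T' : Finset ℕ} {b : Bool} {m m' : Memory}
    (h : Holds C S T b m) (h7 : m' 7 = ind T')
    (hm : ∀ a ∉ [7, 8, 9, 10, 12, 13, 14], m' a = m a) : Holds C S T' b m' := by
  obtain ⟨h0, h1, h2, h3, h4, h5, h6, -, h11⟩ := h
  refine ⟨?_, ?_, ?_, ?_, ?_, ?_, ?_, h7, ?_⟩ <;> rwa [hm _ (by decide)]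

theorem update_ind_zero (T : Finset ℕ) (k : ℕ) : Function.update (ind T) k 0 = ind (T.erase k) := by
  funext i
  rcases eq_or_ne i k with rfl | h
  · simp [ind]
  · simp [ind, h]

theorem update_ind_one (T : Finset ℕ) (k : ℕ) : Function.update (ind T) k 1 = ind (insert k T) := by
  funext i
  rcases eq_or_ne i k with rfl | h
  · simp [ind]
  · simp [ind, h]

/-- Containing a subset with value other than b is a monotone property of T. An element that is
indispensable at its turn therefore remains so as T shrinks, and one greedy pass suffices. -/
theorem shrinkProg_runs {ω : ℕ → Bool} {n : ℕ} {C : Circuit n} {S T₀ : Finset ℕ} {b : Bool}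
    {m : Memory} (h : Holds C S T₀ b m) (hT₀ : T₀ ⊆ Finset.range n)
    (hY : ∃ Y ⊆ T₀, C.evalSet Y ≠ b) :
    Runs codeLanguage ω shrinkProg m (n * (200 * (n + C.size + 1) ^ 2 + 4) + 2) fun m' =>
      ∃ T ⊆ T₀, Holds C S T b m' ∧ C.evalSet T ≠ b ∧ ∀ i ∈ T, C.evalSet (T.erase i) = b := by
  refine Runs.mono (Runs.assign_seq <| Runs.loop_count (B := 200 * (n + C.size + 1) ^ 2 + 3)
    (fun k m' => m' 14 0 = k ∧ ∃ T ⊆ T₀, Holds C S T b m' ∧ (∃ Y ⊆ T, C.evalSet Y ≠ b) ∧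
      ∀ i ∈ T, i < k → ¬ ∃ Y ⊆ T.erase i, C.evalSet Y ≠ b)
    n ?_ ?_ ?_) (by rw [add_assoc _ 3 1]; omega) ?_
  · rintro k m' hk ⟨h14, T, hT, hm', hP, hmin⟩
    refine ⟨by simp [Expr.eval, hm'.inputs, h14, hk], ?_⟩
    have h1 : Holds C S (T.erase k) b
        (m'.write 7 ((Expr.var 14).eval m') ((Expr.const 0).eval m')) := by
      refine hm'.setFree ?_ fun a ha => Memory.write_ne _ _ _ (by rintro rfl; simp at ha)
      simp [Expr.eval, h14, hm'.free, update_ind_zero]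
    refine Runs.mono (Runs.assign_seq <| Runs.seq (queryProg_runs h1) fun m₁ ⟨hf₁, hans⟩ =>
      Runs.assign_seq <| Runs.assign (Q := fun m' => m' 14 0 = k + 1 ∧ ∃ T ⊆ T₀, Holds C S T b m' ∧
        (∃ Y ⊆ T, C.evalSet Y ≠ b) ∧ ∀ i ∈ T, i < k + 1 → ¬ ∃ Y ⊆ T.erase i, C.evalSet Y ≠ b)
        ⟨?_, ?_⟩) (by omega) fun _ h => h
    · simp [Expr.eval, Memory.write_ne, hf₁ 14 (by decide), h14]
    · have h14₁ : m₁ 14 0 = k := by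
        rw [hf₁ 14 (by decide), Memory.write_ne _ _ _ (by decide), h14]
      have h7₁ : m₁ 7 = ind (T.erase k) := by rw [hf₁ 7 (by decide), h1.free]
      by_cases hk' : ∃ Y ⊆ T.erase k, C.evalSet Y ≠ b
      · rw [if_pos hk'] at hans
        refine ⟨T.erase k, (Finset.erase_subset _ _).trans hT, hm'.setFree ?_ fun a ha => ?_, hk', ?_⟩
        · simp [Expr.eval, Memory.write_ne, h14₁, h7₁, hans, update_ind_zero]
        · simp at ha
          simp [Memory.write_ne, ha, hf₁]
        · rintro i hi hik ⟨Y, hYT, hYb⟩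
          rw [Finset.mem_erase] at hi
          exact hmin i hi.2 (by omega)
            ⟨Y, hYT.trans (Finset.erase_subset_erase _ (Finset.erase_subset _ _)), hYb⟩
      · rw [if_neg hk'] at hans
        -- If k were not in T, the erasure would change nothing and the answer would be positive. So
        -- writing back one minus the answer never inserts a new element.
        have hkT : k ∈ T := by
          by_contra hkT
          rw [Finset.erase_eq_of_notMem hkT] at hk'
          exact hk' hP
        refine ⟨T, hT, hm'.setFree ?_ fun a ha => ?_, hP, fun i hi hik => ?_⟩
        · simp [Expr.eval, Memory.write_ne, h14₁, h7₁, hans, update_ind_one, Finset.insert_erase hkT]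
        · simp at ha
          simp [Memory.write_ne, ha, hf₁]
        · rcases Nat.lt_succ_iff_lt_or_eq.1 hik with hlt | rfl
          · exact hmin i hi hlt
          · exact hk'
  · rintro m' ⟨h14, T, -, hm', -⟩
    simp [Expr.eval, hm'.inputs, h14]
  · refine ⟨by simp [Expr.eval], T₀, subset_rfl, h.congr fun a ha => ?_, hY, by simp⟩
    exact Memory.write_ne _ _ _ (by rintro rfl; simp at ha)
  · rintro m' ⟨-, T, hT, hm', ⟨Y, hYT, hYb⟩, hmin⟩
    have hmin' : ∀ i ∈ T, ∀ Y ⊆ T.erase i, C.evalSet Y = b := fun i hi Y hY => by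
      by_contra hne
      exact hmin i hi (Finset.mem_range.1 (hT₀ (hT hi))) ⟨Y, hY, hne⟩
    refine ⟨T, hT, hm', ?_, fun i hi => hmin' i hi _ subset_rfl⟩
    -- A proper subset of T misses some i and hence lies in `T.erase i`, where the value is always
    -- b.
    have : Y = T := by
      refine hYT.antisymm fun i hi => ?_
      by_contra hiY
      exact hYb (hmin' i hi Y (Finset.subset_erase.2 ⟨hYT, hiY⟩))
    rwa [← this]

/-- Moves the parameters out of array `0`, which then holds the empty set. -/
def initProg : Prog :=
  .seq (.set 4 (.var 0)) <|
  .seq (.set 5 (.read 0 (.const 1))) <|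
  .seq (.set 6 (.read 0 (.const 2))) <|
  .seq (.set 0 (.const 0)) <|
  .seq (.assign 0 (.const 1) (.const 0)) <|
  .seq (.assign 0 (.const 2) (.const 0)) <|
  .assign 0 (.const 3) (.const 0)

/-- The untouched arrays 7 and 11 are zero, which already encodes an empty free set and the value
`false`. -/
theorem initProg_runs {L : Set (List Bool)} {ω : ℕ → Bool} {n : ℕ} (C : Circuit n) (r : ℕ) :
    Runs L ω initProg (inputMemory C r) 7 (Holds C ∅ ∅ false) := by
  refine Runs.mono (Runs.assign_seq <| Runs.assign_seq <| Runs.assign_seq <| Runs.assign_seq <|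
    Runs.assign_seq <| Runs.assign_seq <| Runs.assign (Q := fun m' => m' = _) rfl) (by norm_num) ?_
  rintro _ rfl
  refine ⟨?_, ?_, ?_, ?_, ?_, ?_, ?_, ?_, ?_⟩
  · funext i
    rcases i with _ | _ | _ | _ | i <;>
      simp [Memory.write_ne, Function.update, ind, inputMemory, Expr.eval]
  all_goals simp [Memory.write_ne, inputMemory, Expr.eval]
  rfl

/-- Repeatedly adds a minimal sensitive block of the zero vector to the set of fixed variables. -/
def certifyProg : Prog :=
  .seq initProg <|
  .seq queryProg <|
  .seq (.set 11 (.var 10)) <|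
  .seq updateProg <|
  .seq queryProg <|
  .loop (.var 10) <| .seq shrinkProg <| .seq updateProg queryProg

open Classical in
theorem certifyProg_runs {ω : ℕ → Bool} {n : ℕ} (C : Circuit n) (r : ℕ) :
    Runs codeLanguage ω certifyProg (inputMemory C r) (1000 * (n + C.size + 1) ^ 4) fun m =>
      (outputRestriction n m).length ≤ cert C.eval ^ 2 ∧
      IsConstant (restrict C.eval (outputRestriction n m)) := by
  obtain ⟨Z, hZc, hZ⟩ := C.exists_hitting_set
  refine Runs.mono (Runs.seq (initProg_runs C r) fun m₁ h₁ =>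
    Runs.seq (queryProg_runs h₁) fun m₂ ⟨hf₂, hans₂⟩ =>
    Runs.assign_seq <| Runs.seq (updateProg_runs (C := C) (S := ∅) (T := ∅) (b := C.evalSet ∅)
      ?_ (by simp) (by simp)) fun m₃ h₃ =>
    Runs.seq (queryProg_runs h₃) fun m₄ ⟨hf₄, hans₄⟩ =>
    Runs.loop_potential (e := .var 10)
      (B := n * (200 * (n + C.size + 1) ^ 2 + 4) + 2 + (n * 4 + 2 + 200 * (n + C.size + 1) ^ 2))
      -- The potential k counts the free variables. The bound on |S| charges each block, of size at
      -- most `cert C.eval`, to the points where it meets Z.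
      (fun k m => ∃ S ⊆ Finset.range n, S.card + k = n ∧
        Holds C S (Finset.range n \ S) (C.evalSet ∅) m ∧
        S.card ≤ cert C.eval * (S ∩ Z).card ∧
        m 10 0 = if ∃ Y ⊆ Finset.range n \ S, C.evalSet Y ≠ C.evalSet ∅ then 1 else 0) ?_ n m₄ ?_)
    ?_ ?_
  · obtain ⟨h0, h1, h2, h3, h4, h5, h6, h7, h11⟩ := h₁
    -- With an empty free set and b = `false`, the query just evaluates C at the zero vector.
    have hB : m₂ 10 0 = (C.evalSet ∅).toNat := by
      rw [hans₂]
      cases h : C.evalSet ∅ <;> simp [Finset.subset_empty, h]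
    constructor <;> simp [Memory.write_ne, Expr.eval, hf₂, hB, h0, h1, h2, h3, h4, h5, h6, h7]
  · rintro k m ⟨S, hS, hk, hm, hcard, hans⟩ he
    have hY : ∃ Y ⊆ Finset.range n \ S, C.evalSet Y ≠ C.evalSet ∅ := by
      by_contra hY
      exact he (by simp only [Expr.eval, hans, if_neg hY])
    refine Runs.seq (shrinkProg_runs hm Finset.sdiff_subset hY) fun m₅ ⟨T, hTS, h₅, hTb, hmin⟩ =>
      ?_
    have hTn := hTS.trans Finset.sdiff_subset
    have hdisj : Disjoint S T := Finset.disjoint_of_subset_right hTS Finset.disjoint_sdiff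
    have hTc : T.card ≤ cert C.eval := C.card_le_cert_of_sensitive fun i hi => by
      rw [hmin i hi]
      exact hTb.symm
    -- This both pays for the new block and shows that T is nonempty, so that the potential drops.
    have hTZ : 1 ≤ (T ∩ Z).card := Finset.card_pos.2 (hZ T hTb)
    have hTpos : (T ∩ Z).card ≤ T.card := Finset.card_le_card Finset.inter_subset_left
    refine Runs.seq (updateProg_runs h₅ hTn hdisj) fun m₆ h₆ =>
      Runs.mono (queryProg_runs h₆) le_rfl fun m₇ ⟨hf₇, hans₇⟩ => ?_
    have hU : (S ∪ T).card = S.card + T.card := Finset.card_union_of_disjoint hdisj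
    have hUn : (S ∪ T).card ≤ n := by
      simpa using Finset.card_le_card (Finset.union_subset hS hTn)
    refine ⟨n - (S ∪ T).card, by omega, S ∪ T, Finset.union_subset hS hTn, by omega,
      h₆.congr fun a ha => hf₇ a (by simp at ha ⊢; tauto), ?_, hans₇⟩
    rw [Finset.union_inter_distrib_right, Finset.card_union_of_disjoint
      (hdisj.mono Finset.inter_subset_left Finset.inter_subset_left), hU, mul_add]
    exact add_le_add hcard (hTc.trans (Nat.le_mul_of_pos_right _ hTZ))
  · refine ⟨∅, by simp, by simp, ?_, by simp, ?_⟩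
    · simpa using h₃.congr fun a ha => hf₄ a (by simp at ha ⊢; tauto)
    · simpa using hans₄
  · obtain ⟨N, hNdef⟩ : ∃ N, N = n + C.size + 1 := ⟨_, rfl⟩
    have hn : n ≤ N := by omega
    have hN : 1 ≤ N := by omega
    rw [← hNdef]
    have hpow : 1 ≤ N ^ 2 := Nat.one_le_pow _ _ hN
    have hNN : N ≤ N ^ 2 := Nat.le_self_pow (by norm_num) _
    have h1 : n * (200 * N ^ 2 + 4) ≤ 204 * N ^ 3 := by
      calc n * (200 * N ^ 2 + 4) ≤ N * (204 * N ^ 2) := Nat.mul_le_mul hn (by omega)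
        _ = 204 * N ^ 3 := by ring
    have h2 : N ^ 2 ≤ N ^ 3 := Nat.pow_le_pow_right hN (by norm_num)
    have h3 : N ^ 3 ≤ N ^ 4 := Nat.pow_le_pow_right hN (by norm_num)
    -- At most n rounds, each with at most n + 1 queries of quadratic cost; 413 = 204 + 2 + 4 + 2 +
    -- 200 + 1.
    have h4 : n * (n * (200 * N ^ 2 + 4) + 2 + (n * 4 + 2 + 200 * N ^ 2) + 1) ≤ 413 * N ^ 4 := by
      calc _ ≤ N * (413 * N ^ 3) := Nat.mul_le_mul hn (by omega)
        _ = 413 * N ^ 4 := by ring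
    omega
  · rintro m ⟨⟨k, S, hS, -, hm, hcard, hans⟩, he⟩
    constructor
    · rw [outputRestriction_length_eq hS hm.fixed, sq]
      exact hcard.trans (Nat.mul_le_mul_left _
        ((Finset.card_le_card Finset.inter_subset_right).trans hZc))
    · refine isConstant_restrict_outputRestriction C hm.fixed (b := C.evalSet ∅) fun Y hY => ?_
      by_contra hne
      rw [Expr.eval, Expr.eval, hans, if_pos ⟨Y, hY, hne⟩] at he
      exact one_ne_zero he

instance : MeasureTheory.IsProbabilityMeasure coinMeasure := by
  unfold coinMeasure
  infer_instance

end Certification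

/-! ### The main theorem -/

theorem lemma5p1 :
    ∃ L : Set (List Bool), InNP L ∧
    ∃ (A : Prog) (c K : ℕ),
      ∀ (n : ℕ) (C : Circuit n) (δ : ℝ), 0 < δ → δ < 1 →
        (∀ ω : ℕ → Bool, ∃ (s : State) (t : ℕ),
          Exec L ω A ⟨inputMemory C ⌈Real.logb 2 (1 / δ)⌉₊, 0⟩ s t ∧
          (t : ℝ) ≤ c * (n + C.size + Real.log (1 / δ) + 1) ^ c) ∧
        1 - δ ≤ coinMeasure.real {ω : ℕ → Bool | ∃ (s : State) (t : ℕ),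
          Exec L ω A ⟨inputMemory C ⌈Real.logb 2 (1 / δ)⌉₊, 0⟩ s t ∧
          (outputRestriction n s.mem).length ≤ K * cert C.eval ^ 4 ∧
          IsConstant (restrict C.eval (outputRestriction n s.mem))} := by
  refine ⟨codeLanguage, codeLanguage_inNP, certifyProg, 1000, 1,
    fun n C δ hδ hδ1 => ⟨fun ω => ?_, ?_⟩⟩
  · obtain ⟨m, t, he, ht, -⟩ := certifyProg_runs (ω := ω) C ⌈Real.logb 2 (1 / δ)⌉₊ 0
    refine ⟨_, t, he, ?_⟩
    have hlog : 0 ≤ Real.log (1 / δ) := Real.log_nonneg (by rw [le_div_iff₀ hδ]; linarith)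
    have hbase : (n : ℝ) + C.size + 1 ≤ n + C.size + Real.log (1 / δ) + 1 := by linarith
    have hone : (1 : ℝ) ≤ n + C.size + Real.log (1 / δ) + 1 := by
      have : (0 : ℝ) ≤ (n : ℝ) + C.size := by positivity
      linarith
    calc (t : ℝ) ≤ ((1000 * (n + C.size + 1) ^ 4 : ℕ) : ℝ) := by exact_mod_cast ht
      _ = 1000 * ((n : ℝ) + C.size + 1) ^ 4 := by push_cast; ring
      _ ≤ 1000 * ((n : ℝ) + C.size + Real.log (1 / δ) + 1) ^ 4 := by gcongr
      -- A single constant c serves as factor and exponent, so the exponent 4 is raised to 1000;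
      -- this needs the base to be at least 1.
      _ ≤ 1000 * ((n : ℝ) + C.size + Real.log (1 / δ) + 1) ^ 1000 := by
        gcongr
        norm_num
      _ = _ := by push_cast; rfl
  -- Every coin sequence succeeds, so the event has probability 1.
  · rw [Set.eq_univ_of_forall (s := {ω : ℕ → Bool | _}) fun ω => ?_]
    · simp [hδ.le]
    · obtain ⟨m, t, he, -, hlen, hconst⟩ := certifyProg_runs (ω := ω) C ⌈Real.logb 2 (1 / δ)⌉₊ 0
      refine ⟨_, t, he, ?_, hconst⟩
      rw [one_mul]
      refine hlen.trans ?_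
      rcases Nat.eq_zero_or_pos (cert C.eval) with h0 | hpos
      · simp [h0]
      · exact Nat.pow_le_pow_right hpos (by norm_num)
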